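/- Let $n,d\ge 1$ be integers. For a data set $x=(x_1,\dots,x_{3n})\in(\mathbb R^d)^{3n}$ put $$\mu_x=\frac1n\sum_{i=1}^n x_{i+2n},\qquad \Sigma_x=\frac1{2n}\sum_{i=1}^n (x_i-x_{i+n})(x_i-x_{i+n})^{T},$$ and for $\lambda>0$ let $\mathcal G(\lambda)$ be the set of all $x\in(\mathbb R^d)^{3n}$ such that $\Sigma_x$ is invertible and $(x_i-\mu_x)^T\Sigma_x^{-1}(x_i-\mu_x)\le\lambda$ for every $i\in\{1,\dots,3n\}$. The Hamming distance of two data sets is $D_H(x,y)=|\{i: x_i\ne y_i\}|$. Two probability distributions $P,Q$ on the same measurable space are called $(\varepsilon,\delta)$-indistinguishable if $P(W)\le e^{\varepsilon}Q(W)+\delta$ and $Q(W)\le e^{\varepsilon}P(W)+\delta$ for every measurable set $W$. Let $\varepsilon,\delta,\lambda,k>0$ be real numbers such that $$n>2k\lambda\qquad\text{and}\qquad \varepsilon\ge 10k\lambda\left(\frac1{n-2k\lambda}+\frac1n\right)\log\frac2\delta,$$ where $\log$ is the natural logarithm, and let $C$ be a real number with $$C^2=\frac{32k^2}{\varepsilon^2n^2}\cdot\frac{\lambda}{1-2k\lambda/n}\cdot\log\frac{1.25}{\delta}.$$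 Then for all $x,y\in\mathcal G(\lambda)$ with $D_H(x,y)\le k$, the Gaussian distributions $\mathcal N(\mu_x,C^2\Sigma_x)$ and $\mathcal N(\mu_y,C^2\Sigma_y)$ are $(2\varepsilon,(1+e^{\varepsilon})\delta)$-indistinguishable. -/

import Mathlib

open scoped Matrix

namespace RescaledGaussian

/-- A data set of size `3 n` in `ℝ^d`, that is, an element of `ℝ^(3n × d)`.
The points are numbered `0, …, 3 n - 1`. -/
abbrev DataSet (n d : ℕ) : Type := Fin (3 * n) → EuclideanSpace ℝ (Fin d)

/-- Two distributions `P`, `Q` are `(ε, δ)`-indistinguishable. -/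
def Indistinguishable {W : Type*} [MeasurableSpace W] (ε δ : ℝ)
    (P Q : MeasureTheory.Measure W) : Prop :=
  ∀ s : Set W, MeasurableSet s →
    P.real s ≤ Real.exp ε * Q.real s + δ ∧ Q.real s ≤ Real.exp ε * P.real s + δ

open Classical in
/-- The Hamming distance: the number of indices at which the two data sets differ. -/
noncomputable def dist_H {n d : ℕ} (x y : DataSet n d) : ℕ := hammingDist x y

section Points

variable {n d : ℕ} (x : DataSet n d) (i : Fin n)

/-- The `i`-th point of the first third of the data set. -/
def fstPt : EuclideanSpace ℝ (Fin d) := x ⟨i, by have := i.isLt; omega⟩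

/-- The `i`-th point of the second third of the data set. -/
def sndPt : EuclideanSpace ℝ (Fin d) := x ⟨i + n, by have := i.isLt; omega⟩

/-- The `i`-th point of the last third of the data set. -/
def trdPt : EuclideanSpace ℝ (Fin d) := x ⟨i + 2 * n, by have := i.isLt; omega⟩

end Points

/-- The empirical mean `μ_x = (1 / n) ∑ᵢ x_{i+2n}`, computed from the last third. -/
noncomputable def empMean {n d : ℕ} (x : DataSet n d) : EuclideanSpace ℝ (Fin d) :=
  (1 / (n : ℝ)) • ∑ i : Fin n, trdPt x i

/-- The empirical covariance `Σ_x = (1 / (2n)) ∑ᵢ (xᵢ - x_{i+n}) (xᵢ - x_{i+n})ᵀ`, computed from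
the first two thirds. -/
noncomputable def empCov {n d : ℕ} (x : DataSet n d) : Matrix (Fin d) (Fin d) ℝ :=
  (1 / (2 * (n : ℝ))) • ∑ i : Fin n,
    Matrix.vecMulVec (fstPt x i - sndPt x i).ofLp (fstPt x i - sndPt x i).ofLp

/-- The Mahalanobis norm `‖v‖_S = ‖S^(-1/2) v‖₂ = √(vᵀ S⁻¹ v)` for a positive definite `S`. -/
noncomputable def mahalanobis {d : ℕ} (S : Matrix (Fin d) (Fin d) ℝ)
    (v : EuclideanSpace ℝ (Fin d)) : ℝ :=
  Real.sqrt (v.ofLp ⬝ᵥ (S⁻¹ *ᵥ v.ofLp))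

/-- The set `G(lam)` of good data sets. (`Σ_x` is always positive semidefinite, so it is positive
definite when it is invertible.) -/
def Good (n d : ℕ) (lam : ℝ) : Set (DataSet n d) :=
  {x | IsUnit (empCov x) ∧ ∀ i : Fin (3 * n), mahalanobis (empCov x) (x i - empMean x) ^ 2 ≤ lam}

end RescaledGaussian

/-!
A linear change of coordinates turns `Σ_y` into the identity and `Σ_x` into a diagonal matrix `σ`,
and preserves goodness. Changing `k` points moves the rescaled covariance by a controlled amount,
so that `∑ⱼ |1 - σⱼ|` and `‖μ_x - μ_y‖` are both small. Now pass from `N(μ_x, C² Σ_x)` to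
`N(μ_y, C² Σ_y)` by first replacing the covariance and then the mean. Each step compares product
measures, whose Rényi divergences are sums of explicit one-dimensional ones, and Markov's inequality
for a power of the density turns a Rényi bound into an `(ε, δ)`-bound. If `(1 + e^ε) δ ≥ 1`, there
is nothing to prove; otherwise `ε < log (1 / δ)`, which forces the perturbation of the covariance to
be at most `1 / 5`.
-/

namespace RescaledGaussian

open Matrix MeasureTheory ProbabilityTheory
open scoped ENNReal NNReal

section ApproxLE

variable {Ω Ω' : Type*} [MeasurableSpace Ω] [MeasurableSpace Ω'] {P Q R : Measure Ω} {ε δ : ℝ}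

/-- One-sided `(ε, δ)`-indistinguishability. Unlike the symmetric notion, it can be composed along
chains of distributions that are compared in one direction only. -/
def ApproxLE (ε δ : ℝ) (P Q : Measure Ω) : Prop :=
  ∀ s : Set Ω, MeasurableSet s → P.real s ≤ Real.exp ε * Q.real s + δ

theorem indistinguishable_iff_approxLE :
    Indistinguishable ε δ P Q ↔ ApproxLE ε δ P Q ∧ ApproxLE ε δ Q P :=
  forall₂_and

theorem ApproxLE.of_one_le [IsProbabilityMeasure P] (hδ : 1 ≤ δ) : ApproxLE ε δ P Q :=
  fun _ _ ↦ measureReal_le_one.trans (hδ.trans (le_add_of_nonneg_left (by positivity)))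

theorem ApproxLE.trans {ε' δ' : ℝ} (hPQ : ApproxLE ε δ P Q) (hQR : ApproxLE ε' δ' Q R) :
    ApproxLE (ε + ε') (δ + Real.exp ε * δ') P R := fun s hs ↦
  calc P.real s ≤ Real.exp ε * Q.real s + δ := hPQ s hs
    _ ≤ Real.exp ε * (Real.exp ε' * R.real s + δ') + δ := by gcongr; exact hQR s hs
    _ = Real.exp (ε + ε') * R.real s + (δ + Real.exp ε * δ') := by rw [Real.exp_add]; ring

theorem ApproxLE.map (h : ApproxLE ε δ P Q) {f : Ω → Ω'} (hf : Measurable f) :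
    ApproxLE ε δ (P.map f) (Q.map f) := fun s hs ↦ by
  simpa only [map_measureReal_apply hf hs] using h _ (hf hs)

end ApproxLE

section RenyiBound

/-- A bound on the moments of a density: for `t > 0` it says that the Rényi divergence of order
`1 + t` of `P` from `Q` is at most `c / t`. The density is existentially quantified, which spares
identifying Radon-Nikodym derivatives that are only determined almost everywhere. -/
def RenyiBound {Ω : Type*} [MeasurableSpace Ω] (t c : ℝ) (P Q : Measure Ω) : Prop :=
  ∃ r : Ω → ℝ≥0∞, Measurable r ∧ P = Q.withDensity r ∧
    ∫⁻ x, r x ^ t ∂P ≤ ENNReal.ofReal (Real.exp c)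

/-- Split along `{r ≤ exp ε}`: there `P ≤ exp ε • Q`, and Markov's inequality for `r ^ t` bounds
the mass of the complement. -/
theorem RenyiBound.approxLE {Ω : Type*} [MeasurableSpace Ω] {P Q : Measure Ω}
    [IsFiniteMeasure P] [IsFiniteMeasure Q] {t c ε δ : ℝ} (h : RenyiBound t c P Q) (ht : 0 < t)
    (hδ : 0 < δ) (hc : c ≤ t * ε + Real.log δ) : ApproxLE ε δ P Q := by
  obtain ⟨r, hr, hPQ, hmom⟩ := h
  intro s hs
  set e := ENNReal.ofReal (Real.exp ε) with he
  set A := {x | r x ≤ e}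
  have hA : MeasurableSet A := measurableSet_le hr measurable_const
  have he0 : e ^ t ≠ 0 := by simp [he, ENNReal.rpow_eq_zero_iff, Real.exp_pos]
  have hetop : e ^ t ≠ ∞ := ENNReal.rpow_ne_top_of_nonneg ht.le ENNReal.ofReal_ne_top
  have on_A : P (s ∩ A) ≤ e * Q s := by
    rw [hPQ, withDensity_apply _ (hs.inter hA)]
    calc ∫⁻ x in s ∩ A, r x ∂Q ≤ ∫⁻ _ in s ∩ A, e ∂Q :=
          setLIntegral_mono measurable_const fun x hx ↦ hx.2
      _ = e * Q (s ∩ A) := setLIntegral_const _ _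
      _ ≤ e * Q s := by gcongr; exact Set.inter_subset_left
  have moment : ∫⁻ x, r x ^ t ∂P ≤ e ^ t * ENNReal.ofReal δ := by
    refine hmom.trans ?_
    rw [he, ENNReal.ofReal_rpow_of_pos (Real.exp_pos ε), ← Real.exp_mul,
      ← ENNReal.ofReal_mul (Real.exp_pos _).le]
    refine ENNReal.ofReal_le_ofReal ((Real.exp_le_exp.2 hc).trans_eq ?_)
    rw [Real.exp_add, Real.exp_log hδ, mul_comm ε]
  have off_A : P (s \ A) ≤ ENNReal.ofReal δ := by
    refine (ENNReal.mul_le_mul_iff_right he0 hetop).1 ?_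
    calc e ^ t * P (s \ A) ≤ e ^ t * P {x | e ^ t ≤ r x ^ t} := by
          gcongr
          exact fun x hx ↦ ENNReal.rpow_le_rpow (not_le.1 hx.2).le ht.le
      _ ≤ ∫⁻ x, r x ^ t ∂P := mul_meas_ge_le_lintegral (hr.pow_const t) _
      _ ≤ e ^ t * ENNReal.ofReal δ := moment
  have hPs : P s ≤ e * Q s + ENNReal.ofReal δ :=
    (measure_le_inter_add_sdiff P s A).trans (add_le_add on_A off_A)
  have hreal := ENNReal.toReal_mono (by finiteness) hPs
  rwa [ENNReal.toReal_add (by finiteness) (by finiteness), ENNReal.toReal_mul,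
    ENNReal.toReal_ofReal (Real.exp_pos _).le, ENNReal.toReal_ofReal hδ.le] at hreal

variable {ι : Type*} [Fintype ι] {Ω : ι → Type*} [∀ i, MeasurableSpace (Ω i)]

theorem lintegral_pi_prod (μ : ∀ i, Measure (Ω i)) [∀ i, IsProbabilityMeasure (μ i)]
    {f : ∀ i, Ω i → ℝ≥0∞} (hf : ∀ i, Measurable (f i)) :
    ∫⁻ x, ∏ i, f i (x i) ∂Measure.pi μ = ∏ i, ∫⁻ y, f i y ∂μ i := by
  rw [lintegral_prod_eq_prod_lintegral_of_indepFun Finset.univ (fun i (x : ∀ i, Ω i) ↦ f i (x i))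
    (iIndepFun_pi fun i ↦ (hf i).aemeasurable) fun i ↦ (hf i).comp (measurable_pi_apply i)]
  exact Finset.prod_congr rfl fun i _ ↦ (measurePreserving_eval μ i).lintegral_comp (hf i)

theorem pi_withDensity (Q : ∀ i, Measure (Ω i)) [∀ i, IsProbabilityMeasure (Q i)]
    {f : ∀ i, Ω i → ℝ≥0∞} (hf : ∀ i, Measurable (f i))
    [∀ i, SigmaFinite ((Q i).withDensity (f i))] :
    Measure.pi (fun i ↦ (Q i).withDensity (f i)) =
      (Measure.pi Q).withDensity fun x ↦ ∏ i, f i (x i) := by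
  refine Measure.pi_eq fun s hs ↦ ?_
  have indicator_prod : (Set.univ.pi s).indicator (fun x ↦ ∏ i, f i (x i)) =
      fun x ↦ ∏ i, (s i).indicator (f i) (x i) := by
    classical
    ext x
    simp [Set.indicator_apply, Finset.prod_ite_zero]
  rw [withDensity_apply _ (.univ_pi hs), ← lintegral_indicator (.univ_pi hs), indicator_prod,
    lintegral_pi_prod Q fun i ↦ (hf i).indicator (hs i)]
  exact Finset.prod_congr rfl fun i _ ↦ by
    rw [lintegral_indicator (hs i), withDensity_apply _ (hs i)]

theorem RenyiBound.pi {P Q : ∀ i, Measure (Ω i)} [∀ i, IsProbabilityMeasure (P i)]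
    [∀ i, IsProbabilityMeasure (Q i)] {t : ℝ} {c : ι → ℝ} (ht : 0 ≤ t)
    (h : ∀ i, RenyiBound t (c i) (P i) (Q i)) :
    RenyiBound t (∑ i, c i) (Measure.pi P) (Measure.pi Q) := by
  choose r hr hPQ hmom using h
  have (i : ι) : SigmaFinite ((Q i).withDensity (r i)) := hPQ i ▸ inferInstance
  refine ⟨fun x ↦ ∏ i, r i (x i), by fun_prop, ?_, ?_⟩
  · rw [← pi_withDensity Q hr, ← funext hPQ]
  · calc ∫⁻ x, (∏ i, r i (x i)) ^ t ∂Measure.pi P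
        = ∏ i, ∫⁻ y, r i y ^ t ∂P i := by
          simp_rw [← ENNReal.prod_rpow_of_nonneg ht]
          exact lintegral_pi_prod P fun i ↦ (hr i).pow_const t
      _ ≤ ∏ i, ENNReal.ofReal (Real.exp (c i)) := Finset.prod_le_prod' fun i _ ↦ hmom i
      _ = ENNReal.ofReal (Real.exp (∑ i, c i)) := by
          rw [Real.exp_sum, ENNReal.ofReal_prod_of_nonneg fun i _ ↦ (Real.exp_pos _).le]

end RenyiBound

section GaussianReal

/-- The logarithm of the density of `N(a, v)` relative to `N(b, w)`, the privacy loss of the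
differential privacy literature. -/
noncomputable def gaussianLogRatio (a : ℝ) (v : ℝ≥0) (b : ℝ) (w : ℝ≥0) (x : ℝ) : ℝ :=
  Real.log (w / v) / 2 + (x - b) ^ 2 / (2 * w) - (x - a) ^ 2 / (2 * v)

variable {v w : ℝ≥0}

theorem gaussianReal_eq_withDensity_exp_logRatio (a b : ℝ) (hv : v ≠ 0) (hw : w ≠ 0) :
    gaussianReal a v = (gaussianReal b w).withDensity fun x ↦
      ENNReal.ofReal (Real.exp (gaussianLogRatio a v b w x)) := by
  have hw' : (0 : ℝ) < w := by positivity
  have pdf_mul (x : ℝ) : gaussianPDFReal a v x =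
      gaussianPDFReal b w x * Real.exp (gaussianLogRatio a v b w x) := by
    have hlog : Real.exp (Real.log (w / v) / 2) = √w / √v := by
      rw [← Real.sqrt_div hw'.le, ← Real.log_sqrt (by positivity), Real.exp_log (by positivity)]
    have hexp : Real.exp (-(x - a) ^ 2 / (2 * v)) = Real.exp (-(x - b) ^ 2 / (2 * w)) *
        Real.exp ((x - b) ^ 2 / (2 * w) - (x - a) ^ 2 / (2 * v)) := by
      rw [← Real.exp_add]
      ring_nf
    rw [gaussianPDFReal, gaussianPDFReal, gaussianLogRatio, add_sub_assoc, Real.exp_add, hlog, hexp,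
      Real.sqrt_mul (by positivity) (v : ℝ), Real.sqrt_mul (by positivity) (w : ℝ)]
    field_simp
  rw [gaussianReal_of_var_ne_zero a hv, gaussianReal_of_var_ne_zero b hw,
    ← withDensity_mul _ (measurable_gaussianPDF b w) (by unfold gaussianLogRatio; fun_prop)]
  congr 1
  ext x
  rw [Pi.mul_apply, gaussianPDF, gaussianPDF, pdf_mul,
    ENNReal.ofReal_mul (gaussianPDFReal_nonneg _ _ _)]

theorem renyiBound_gaussianReal_of_mgf_eq {a b t c : ℝ} (hv : v ≠ 0) (hw : w ≠ 0)
    (h : mgf (gaussianLogRatio a v b w) (gaussianReal a v) t = Real.exp c) :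
    RenyiBound t c (gaussianReal a v) (gaussianReal b w) := by
  refine ⟨_, by unfold gaussianLogRatio; fun_prop,
    gaussianReal_eq_withDensity_exp_logRatio a b hv hw, ?_⟩
  have hmom : Integrable (fun x ↦ Real.exp (t * gaussianLogRatio a v b w x)) (gaussianReal a v) :=
    not_imp_comm.1 integral_undef (h.trans_ne (Real.exp_ne_zero c))
  simp_rw [ENNReal.ofReal_rpow_of_pos (Real.exp_pos _), ← Real.exp_mul,
    mul_comm (gaussianLogRatio _ _ _ _ _)]
  rw [← ofReal_integral_eq_lintegral_ofReal hmom (.of_forall fun _ ↦ (Real.exp_pos _).le), ← h, mgf]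

theorem renyiBound_gaussianReal_of_var_eq (a b t : ℝ) (hv : v ≠ 0) :
    RenyiBound t (t * (1 + t) * (a - b) ^ 2 / (2 * v)) (gaussianReal a v) (gaussianReal b v) := by
  have hv' : (v : ℝ) ≠ 0 := by simpa using hv
  refine renyiBound_gaussianReal_of_mgf_eq hv hv ?_
  have linear : gaussianLogRatio a v b v =
      fun x ↦ (a - b) / v * id x + (b ^ 2 - a ^ 2) / (2 * v) := by
    ext x
    rw [gaussianLogRatio, div_self hv', Real.log_one, id]
    field_simp
    ring
  rw [linear, mgf_add_const, mgf_const_mul, mgf_id_gaussianReal, ← Real.exp_add]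
  congr 1
  field_simp
  ring

theorem mgf_sq_sub_gaussianReal (a : ℝ) {s : ℝ} (hv : v ≠ 0) (hs : 0 < 1 - 2 * s * v) :
    mgf (fun x ↦ (x - a) ^ 2) (gaussianReal a v) s = (√(1 - 2 * s * v))⁻¹ := by
  have integrand (x : ℝ) : gaussianPDFReal a v x • Real.exp (s * (x - a) ^ 2) =
      (√(2 * Real.pi * v))⁻¹ * Real.exp (-((1 - 2 * s * v) / (2 * v)) * (x - a) ^ 2) := by
    rw [gaussianPDFReal, smul_eq_mul, mul_assoc, ← Real.exp_add]
    congr 2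
    field_simp
    ring
  rw [mgf, integral_gaussianReal_eq_integral_smul hv]
  simp_rw [integrand]
  rw [integral_const_mul, integral_sub_right_eq_self
      (fun x ↦ Real.exp (-((1 - 2 * s * v) / (2 * v)) * x ^ 2)) a, integral_gaussian,
    show Real.pi / ((1 - 2 * s * v) / (2 * v)) = 2 * Real.pi * v / (1 - 2 * s * v) by field_simp,
    Real.sqrt_div (by positivity)]
  field_simp

theorem renyiBound_gaussianReal_of_mean_eq (a : ℝ) {t : ℝ} (hv : v ≠ 0) (hw : w ≠ 0)
    (ht : 0 < 1 + t * (1 - v / w)) :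
    RenyiBound t (-(t / 2) * Real.log (v / w) - Real.log (1 + t * (1 - v / w)) / 2)
      (gaussianReal a v) (gaussianReal a w) := by
  have hw' : (w : ℝ) ≠ 0 := by simpa using hw
  refine renyiBound_gaussianReal_of_mgf_eq hv hw ?_
  have quadratic : gaussianLogRatio a v a w =
      fun x ↦ (1 / w - 1 / v) / 2 * (x - a) ^ 2 + Real.log (w / v) / 2 := by
    ext x
    rw [gaussianLogRatio]
    ring
  have hs : 1 - 2 * ((1 / w - 1 / v) / 2 * t) * v = 1 + t * (1 - v / w) := by
    field_simp
    ring
  rw [quadratic, mgf_add_const, mgf_const_mul, mgf_sq_sub_gaussianReal a hv (hs ▸ ht), hs,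
    Real.exp_sub, ← Real.log_sqrt ht.le, Real.exp_log (Real.sqrt_pos.2 ht), ← inv_div (v : ℝ),
    Real.log_inv, inv_mul_eq_div]
  congr 2
  ring

end GaussianReal

section RenyiExponent

theorem neg_log_le_of_le {c x : ℝ} (hc : 0 < c) (hcx : c ≤ x) :
    -Real.log x ≤ (1 - x) + (1 - x) ^ 2 / c := by
  have hx : 0 < x := hc.trans_le hcx
  calc -Real.log x ≤ x⁻¹ - 1 := by linarith [Real.one_sub_inv_le_log_of_pos hx]
    _ = (1 - x) + (1 - x) ^ 2 / x := by
        field_simp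
        ring
    _ ≤ (1 - x) + (1 - x) ^ 2 / c := by gcongr

/-- The terms of first order in `1 - ρ` cancel, so the exponent is quadratic in `1 - ρ`. -/
theorem renyi_exponent_le {t ρ : ℝ} (ht : 0 ≤ t) (hρ : 4 / 5 ≤ ρ) (htρ : 1 / 2 ≤ 1 + t * (1 - ρ)) :
    -(t / 2) * Real.log ρ - Real.log (1 + t * (1 - ρ)) / 2 ≤
      (5 / 8 * t + t ^ 2) * (1 - ρ) ^ 2 := by
  have h₁ : t * -Real.log ρ ≤ t * ((1 - ρ) + (1 - ρ) ^ 2 / (4 / 5)) :=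
    mul_le_mul_of_nonneg_left (neg_log_le_of_le (by norm_num) hρ) ht
  have h₂ := neg_log_le_of_le (by norm_num) htρ
  linarith

theorem half_le_one_add_mul {τ r : ℝ} (hτ : 0 < τ) (hr : |r| ≤ τ) :
    1 / 2 ≤ 1 + 1 / (2 * τ) * r := by
  have : 1 / (2 * τ) * -r ≤ 1 / (2 * τ) * τ := by gcongr; exact (neg_le_abs r).trans hr
  rw [show 1 / (2 * τ) * τ = 1 / 2 by field_simp] at this
  linarith

theorem sum_renyi_exponent_le {ι : Type*} [Fintype ι] {ρ : ι → ℝ} {τ : ℝ} (hτ : 0 < τ)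
    (hτ5 : τ ≤ 1 / 5) (hρ : ∑ i, |1 - ρ i| ≤ τ) :
    ∑ i, (-(1 / (2 * τ) / 2) * Real.log (ρ i) - Real.log (1 + 1 / (2 * τ) * (1 - ρ i)) / 2) ≤
      5 / 16 * τ + 1 / 4 := by
  have abs_le (i : ι) : |1 - ρ i| ≤ τ :=
    (Finset.single_le_sum (fun j _ ↦ abs_nonneg (1 - ρ j)) (Finset.mem_univ i)).trans hρ
  have sum_sq_le : ∑ i, (1 - ρ i) ^ 2 ≤ τ ^ 2 :=
    calc ∑ i, (1 - ρ i) ^ 2 = ∑ i, |1 - ρ i| ^ 2 := by simp only [sq_abs]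
      _ ≤ (∑ i, |1 - ρ i|) ^ 2 := Finset.sum_sq_le_sq_sum_of_nonneg fun i _ ↦ abs_nonneg _
      _ ≤ τ ^ 2 := by gcongr
  calc ∑ i, (-(1 / (2 * τ) / 2) * Real.log (ρ i) - Real.log (1 + 1 / (2 * τ) * (1 - ρ i)) / 2)
      ≤ ∑ i, (5 / 8 * (1 / (2 * τ)) + (1 / (2 * τ)) ^ 2) * (1 - ρ i) ^ 2 :=
        Finset.sum_le_sum fun i _ ↦ renyi_exponent_le (by positivity)
          (by linarith [(le_abs_self _).trans (abs_le i)]) (half_le_one_add_mul hτ (abs_le i))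
    _ ≤ (5 / 8 * (1 / (2 * τ)) + (1 / (2 * τ)) ^ 2) * τ ^ 2 := by rw [← Finset.mul_sum]; gcongr
    _ = 5 / 16 * τ + 1 / 4 := by
        field_simp
        ring

end RenyiExponent

section DiagonalCovariance

variable {ι : Type*} [Fintype ι] [DecidableEq ι] {ε δ : ℝ}

theorem multivariateGaussian_diagonal (μ : EuclideanSpace ℝ ι) {σ : ι → ℝ} (hσ : ∀ i, 0 ≤ σ i) :
    multivariateGaussian μ (diagonal σ) =
      (Measure.pi fun i ↦ gaussianReal (μ i) (σ i).toNNReal).map (WithLp.toLp 2) := by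
  refine Measure.ext_of_charFun (funext fun x ↦ ?_)
  rw [charFun_pi, charFun_multivariateGaussian (posSemidef_diagonal_iff.2 hσ)]
  simp only [charFun_gaussianReal, ← Complex.exp_sum, Finset.sum_sub_distrib, ← Finset.sum_div,
    ← Finset.sum_mul]
  congr 2
  · simp [PiLp.inner_apply, mul_comm]
  · simp [dotProduct, mulVec_diagonal, hσ, pow_two, mul_left_comm]

theorem approxLE_multivariateGaussian_diagonal {a b : EuclideanSpace ℝ ι} {σ τ c : ι → ℝ} {t : ℝ}
    (hσ : ∀ i, 0 ≤ σ i) (hτ : ∀ i, 0 ≤ τ i) (ht : 0 < t) (hδ : 0 < δ)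
    (hc : ∑ i, c i ≤ t * ε + Real.log δ)
    (h : ∀ i, RenyiBound t (c i) (gaussianReal (a i) (σ i).toNNReal)
      (gaussianReal (b i) (τ i).toNNReal)) :
    ApproxLE ε δ (multivariateGaussian a (diagonal σ)) (multivariateGaussian b (diagonal τ)) := by
  rw [multivariateGaussian_diagonal a hσ, multivariateGaussian_diagonal b hτ]
  exact ((RenyiBound.pi ht.le h).approxLE ht hδ hc).map (by fun_prop)

theorem approxLE_multivariateGaussian_of_mean {a b : EuclideanSpace ℝ ι} {v L : ℝ} (hv : 0 < v)
    (hδ : 0 < δ) (hε : 0 < ε) (hεL : ε ≤ L) (hδL : -Real.log δ ≤ L)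
    (hab : ‖a - b‖ ^ 2 ≤ v * ε ^ 2 / (4 * L)) :
    ApproxLE ε δ (multivariateGaussian a (v • 1)) (multivariateGaussian b (v • 1)) := by
  have hL : 0 < L := hε.trans_le hεL
  set t := 2 * L / ε with ht
  have ht0 : 0 < t := by positivity
  rw [← diagonal_one, ← diagonal_smul]
  refine approxLE_multivariateGaussian_diagonal (t := t) (by simp [hv.le]) (by simp [hv.le]) ht0 hδ
    ?_ fun i ↦ renyiBound_gaussianReal_of_var_eq _ _ t (by simpa using hv)
  calc ∑ i, t * (1 + t) * (a i - b i) ^ 2 / (2 * ((v • fun _ ↦ (1 : ℝ)) i).toNNReal)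
      = t * (1 + t) * ‖a - b‖ ^ 2 / (2 * v) := by
        simp [EuclideanSpace.real_norm_sq_eq, ← Finset.mul_sum, ← Finset.sum_div, hv.le]
    _ ≤ t * (1 + t) * (v * ε ^ 2 / (4 * L)) / (2 * v) := by gcongr
    _ = ε / 4 + L / 2 := by
        rw [ht]
        field_simp
        ring
    _ ≤ t * ε + Real.log δ := by
        rw [ht, div_mul_cancel₀ _ hε.ne']
        linarith

theorem approxLE_multivariateGaussian_of_cov (μ : EuclideanSpace ℝ ι) {ρ : ι → ℝ} {v τ : ℝ}
    (hv : 0 < v) (hδ : 0 < δ) (hδ1 : δ ≤ 1) (hτ : 0 < τ) (hτ5 : τ ≤ 1 / 5)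
    (hρ : ∑ i, |1 - ρ i| ≤ τ) (hτε : 5 * τ * Real.log (2 / δ) ≤ ε) :
    ApproxLE ε δ (multivariateGaussian μ (v • diagonal ρ)) (multivariateGaussian μ (v • 1)) := by
  have abs_le (i : ι) : |1 - ρ i| ≤ τ :=
    (Finset.single_le_sum (fun j _ ↦ abs_nonneg (1 - ρ j)) (Finset.mem_univ i)).trans hρ
  have hvρ (i : ι) : 0 < v * ρ i := mul_pos hv (by linarith [(le_abs_self _).trans (abs_le i)])
  have var_ratio (i : ι) :
      (((v • ρ) i).toNNReal / ((v • fun _ ↦ (1 : ℝ)) i).toNNReal : ℝ) = ρ i := by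
    simp [hv.le, (hvρ i).le, hv.ne']
  rw [← diagonal_one, ← diagonal_smul, ← diagonal_smul]
  refine approxLE_multivariateGaussian_diagonal (t := 1 / (2 * τ)) (fun i ↦ (hvρ i).le)
    (by simp [hv.le]) (by positivity) hδ ?_ fun i ↦
    renyiBound_gaussianReal_of_mean_eq _ (by simpa using hvρ i) (by simpa using hv)
      (by rw [var_ratio]; linarith [half_le_one_add_mul hτ (abs_le i)])
  simp_rw [var_ratio]
  calc _ ≤ 5 / 16 * τ + 1 / 4 := sum_renyi_exponent_le hτ hτ5 hρ
    _ ≤ 5 / 2 * Real.log (2 / δ) + Real.log δ := by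
        rw [Real.log_div two_ne_zero hδ.ne']
        linarith [Real.log_two_gt_d9, Real.log_nonpos hδ.le hδ1]
    _ = 1 / (2 * τ) * (5 * τ * Real.log (2 / δ)) + Real.log δ := by field_simp
    _ ≤ 1 / (2 * τ) * ε + Real.log δ := by gcongr

end DiagonalCovariance

section Whitening

variable {ι : Type*} [Fintype ι] [DecidableEq ι]

open scoped MatrixOrder ComplexOrder in
theorem exists_whitening {𝕜 : Type*} [RCLike 𝕜] {A B : Matrix ι ι 𝕜} (hA : A.IsHermitian)
    (hB : B.PosDef) : ∃ (M : Matrix ι ι 𝕜) (σ : ι → ℝ), IsUnit M ∧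
      M * A * Mᴴ = diagonal (fun i ↦ (σ i : 𝕜)) ∧ M * B * Mᴴ = 1 := by
  obtain ⟨Y, hY, rfl⟩ := CStarAlgebra.isStrictlyPositive_iff_eq_star_mul_self.1
    hB.isStrictlyPositive
  have hdet : IsUnit Y.det := (isUnit_iff_isUnit_det Y).1 hY
  have hdet' : IsUnit Yᴴ.det := (isUnit_iff_isUnit_det _).1 hY.star
  have hA' : (Yᴴ⁻¹ * A * Y⁻¹).IsHermitian := by
    simpa [conjTranspose_nonsing_inv] using isHermitian_mul_mul_conjTranspose Yᴴ⁻¹ hA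
  set U : Matrix ι ι 𝕜 := ↑hA'.eigenvectorUnitary with hU
  have hUU : Uᴴ * U = 1 := Unitary.coe_star_mul_self hA'.eigenvectorUnitary
  have hdiag : Uᴴ * (Yᴴ⁻¹ * A * Y⁻¹) * U = diagonal (fun i ↦ (hA'.eigenvalues i : 𝕜)) := by
    simpa [Unitary.conjStarAlgAut_apply, star_eq_conjTranspose, hU, Function.comp_def]
      using hA'.conjStarAlgAut_star_eigenvectorUnitary
  refine ⟨Uᴴ * Yᴴ⁻¹, hA'.eigenvalues, ?_, ?_, ?_⟩
  · exact (Unitary.isUnit_coe (U := hA'.eigenvectorUnitary)).star.mul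
      (isUnit_nonsing_inv_iff.2 hY.star)
  · simpa [conjTranspose_mul, conjTranspose_nonsing_inv, Matrix.mul_assoc] using hdiag
  · rw [conjTranspose_mul, conjTranspose_nonsing_inv, conjTranspose_conjTranspose,
      conjTranspose_conjTranspose, star_eq_conjTranspose]
    calc Uᴴ * Yᴴ⁻¹ * (Yᴴ * Y) * (Y⁻¹ * U) = Uᴴ * ((Yᴴ⁻¹ * Yᴴ) * (Y * Y⁻¹)) * U := by
          simp only [Matrix.mul_assoc]
      _ = 1 := by
          rw [nonsing_inv_mul _ hdet', mul_nonsing_inv _ hdet, Matrix.mul_one, Matrix.mul_one, hUU]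

theorem map_toEuclideanCLM_multivariateGaussian (A : Matrix ι ι ℝ) (μ : EuclideanSpace ℝ ι)
    {S : Matrix ι ι ℝ} (hS : S.PosSemidef) :
    (multivariateGaussian μ S).map (toEuclideanCLM (𝕜 := ℝ) A) =
      multivariateGaussian (toEuclideanCLM (𝕜 := ℝ) A μ) (A * S * Aᵀ) := by
  have hAS : (A * S * Aᵀ).PosSemidef := by
    simpa using hS.mul_mul_conjTranspose_same A
  have inner_image (x y : EuclideanSpace ℝ ι) : inner ℝ (toEuclideanCLM (𝕜 := ℝ) A y) x =
      inner ℝ y (toEuclideanCLM (𝕜 := ℝ) Aᵀ x) := by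
    rw [← ContinuousLinearMap.adjoint_inner_right, ← ContinuousLinearMap.star_eq_adjoint,
      ← map_star, star_eq_conjTranspose, conjTranspose_eq_transpose_of_trivial]
  refine Measure.ext_of_charFun (funext fun x ↦ ?_)
  rw [charFun_apply, integral_map (by fun_prop) (by fun_prop)]
  simp_rw [inner_image]
  rw [← charFun_apply, charFun_multivariateGaussian hS, charFun_multivariateGaussian hAS,
    real_inner_comm, ← inner_image, real_inner_comm, ofLp_toEuclideanCLM, ← mulVec_mulVec,
    ← mulVec_mulVec, dotProduct_mulVec _ A, ← mulVec_transpose]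

theorem ApproxLE.of_conjugate {ε δ : ℝ} {M S T : Matrix ι ι ℝ} {a b : EuclideanSpace ℝ ι}
    (hM : IsUnit M) (hS : S.PosSemidef) (hT : T.PosSemidef)
    (h : ApproxLE ε δ (multivariateGaussian (toEuclideanCLM (𝕜 := ℝ) M a) (M * S * Mᵀ))
      (multivariateGaussian (toEuclideanCLM (𝕜 := ℝ) M b) (M * T * Mᵀ))) :
    ApproxLE ε δ (multivariateGaussian a S) (multivariateGaussian b T) := by
  have inv_comp : toEuclideanCLM (𝕜 := ℝ) M⁻¹ ∘ toEuclideanCLM (𝕜 := ℝ) M = id := by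
    ext c : 2
    simp [mulVec_mulVec, nonsing_inv_mul _ ((isUnit_iff_isUnit_det M).1 hM)]
  have inv_map (c : EuclideanSpace ℝ ι) {R : Matrix ι ι ℝ} (hR : R.PosSemidef) :
      (multivariateGaussian (toEuclideanCLM (𝕜 := ℝ) M c) (M * R * Mᵀ)).map
        (toEuclideanCLM (𝕜 := ℝ) M⁻¹) = multivariateGaussian c R := by
    rw [← map_toEuclideanCLM_multivariateGaussian M c hR,
      Measure.map_map (by fun_prop) (by fun_prop), inv_comp, Measure.map_id]
  simpa only [inv_map a hS, inv_map b hT] using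
    h.map (f := toEuclideanCLM (𝕜 := ℝ) M⁻¹) (by fun_prop)

end Whitening

section LinearImage

variable {n d : ℕ} {x y : DataSet n d} {A : Matrix (Fin d) (Fin d) ℝ} {lam : ℝ}

/-- The data set `(A xᵢ)ᵢ`, used to pass to coordinates in which the covariances are diagonal. -/
noncomputable def linearImage (A : Matrix (Fin d) (Fin d) ℝ) (x : DataSet n d) : DataSet n d :=
  fun i ↦ toEuclideanCLM (𝕜 := ℝ) A (x i)

theorem empMean_linearImage (A : Matrix (Fin d) (Fin d) ℝ) (x : DataSet n d) :
    empMean (linearImage A x) = toEuclideanCLM (𝕜 := ℝ) A (empMean x) := by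
  simp only [empMean, map_smul, map_sum]
  rfl

theorem empCov_linearImage (A : Matrix (Fin d) (Fin d) ℝ) (x : DataSet n d) :
    empCov (linearImage A x) = A * empCov x * Aᵀ := by
  have diff (i : Fin n) : (fstPt (linearImage A x) i - sndPt (linearImage A x) i).ofLp =
      A *ᵥ (fstPt x i - sndPt x i).ofLp := by
    simp [fstPt, sndPt, linearImage, mulVec_sub]
  simp only [empCov, diff, Matrix.mul_smul, Matrix.smul_mul, Matrix.mul_sum, Matrix.sum_mul,
    mul_vecMulVec, vecMulVec_mul, vecMul_transpose]

theorem mahalanobis_toEuclideanCLM (hA : IsUnit A) (S : Matrix (Fin d) (Fin d) ℝ)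
    (v : EuclideanSpace ℝ (Fin d)) :
    mahalanobis (A * S * Aᵀ) (toEuclideanCLM (𝕜 := ℝ) A v) = mahalanobis S v := by
  have hdet : IsUnit A.det := (isUnit_iff_isUnit_det A).1 hA
  have hconj : Aᵀ * ((Aᵀ)⁻¹ * (S⁻¹ * A⁻¹)) * A = S⁻¹ := by
    rw [mul_nonsing_inv_cancel_left _ _ (by rwa [det_transpose]),
      nonsing_inv_mul_cancel_right _ _ hdet]
  rw [mahalanobis, mahalanobis, ofLp_toEuclideanCLM, Matrix.mul_inv_rev, Matrix.mul_inv_rev,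
    mulVec_mulVec, ← vecMul_transpose, ← dotProduct_mulVec, mulVec_mulVec, ← Matrix.mul_assoc,
    hconj]

theorem linearImage_mem_good (hA : IsUnit A) (hx : x ∈ Good n d lam) :
    linearImage A x ∈ Good n d lam := by
  refine ⟨?_, fun i ↦ ?_⟩
  · rw [empCov_linearImage]
    exact (hA.mul hx.1).mul (A.isUnit_transpose.2 hA)
  · rw [empCov_linearImage, empMean_linearImage, linearImage, ← map_sub,
      mahalanobis_toEuclideanCLM hA]
    exact hx.2 i

theorem dist_H_linearImage_le (A : Matrix (Fin d) (Fin d) ℝ) (x y : DataSet n d) :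
    dist_H (linearImage A x) (linearImage A y) ≤ dist_H x y :=
  hammingDist_comp_le_hammingDist fun _ ↦ toEuclideanCLM (𝕜 := ℝ) A

theorem posSemidef_empCov (x : DataSet n d) : (empCov x).PosSemidef := by
  refine (posSemidef_sum _ fun i _ ↦ ?_).smul (by positivity)
  simpa using posSemidef_vecMulVec_self_star (fstPt x i - sndPt x i).ofLp

theorem posDef_empCov (hx : IsUnit (empCov x)) : (empCov x).PosDef :=
  (posSemidef_empCov x).posDef_iff_isUnit.2 hx

end LinearImage

section Perturbation

variable {n d : ℕ} {x y : DataSet n d} {σ : Fin d → ℝ} {lam k : ℝ}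

theorem sum_le_mul_of_dist_H_le (hxy : (dist_H x y : ℝ) ≤ k) {g : Fin n → ℝ} {c : ℝ} (hc : 0 ≤ c)
    (hg : ∀ i, g i ≤ c)
    (hg0 : ∀ i, fstPt x i = fstPt y i → sndPt x i = sndPt y i → trdPt x i = trdPt y i → g i ≤ 0) :
    ∑ i, g i ≤ k * c := by
  classical
  let index (p : Fin (3 * n)) : Fin n := ⟨p % n, Nat.mod_lt _ (by have := p.isLt; omega)⟩
  set D : Finset (Fin (3 * n)) := {p | x p ≠ y p} with hD
  calc ∑ i, g i ≤ ∑ i, if i ∈ D.image index then c else 0 := by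
        refine Finset.sum_le_sum fun i _ ↦ ?_
        split_ifs with hi
        · exact hg i
        · have agree (p : Fin (3 * n)) (hp : p % n = (i : ℕ)) : x p = y p := by
            by_contra h
            exact hi (Finset.mem_image.2 ⟨p, by simpa [hD] using h, Fin.ext hp⟩)
          have := Nat.mod_eq_of_lt i.isLt
          exact hg0 i (agree _ this) (agree _ (by simpa)) (agree _ (by simpa))
    _ = (D.image index).card * c := by
        rw [Finset.sum_ite_mem, Finset.univ_inter, Finset.sum_const, nsmul_eq_mul]
    _ ≤ k * c := by
        gcongr
        refine (Nat.cast_le.2 Finset.card_image_le).trans (le_of_eq_of_le ?_ hxy)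
        rw [dist_H, hammingDist, hD]

theorem norm_empMean_sub_le (hn : 0 < n) {r : ℝ} (hr : 0 ≤ r) (hxy : (dist_H x y : ℝ) ≤ k)
    (hx : ∀ p, ‖x p - empMean x‖ ≤ r) (hy : ∀ p, ‖y p - empMean y‖ ≤ r) :
    (n - k) * ‖empMean x - empMean y‖ ≤ 2 * k * r := by
  have term_le (i : Fin n) : ‖trdPt x i - trdPt y i‖ ≤ 2 * r + ‖empMean x - empMean y‖ :=
    calc ‖trdPt x i - trdPt y i‖
        = ‖trdPt x i - empMean x - (trdPt y i - empMean y) + (empMean x - empMean y)‖ := by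
          congr 1
          abel
      _ ≤ ‖trdPt x i - empMean x‖ + ‖trdPt y i - empMean y‖ + ‖empMean x - empMean y‖ :=
          (norm_add_le _ _).trans (by gcongr; exact norm_sub_le _ _)
      _ ≤ 2 * r + ‖empMean x - empMean y‖ := by
          rw [two_mul]
          gcongr
          exacts [hx _, hy _]
  have mean_le : n * ‖empMean x - empMean y‖ ≤ k * (2 * r + ‖empMean x - empMean y‖) :=
    calc n * ‖empMean x - empMean y‖ = ‖∑ i, (trdPt x i - trdPt y i)‖ := by
          rw [empMean, empMean, ← smul_sub, ← Finset.sum_sub_distrib, norm_smul, Real.norm_eq_abs,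
            abs_of_pos (by positivity)]
          field_simp
      _ ≤ ∑ i, ‖trdPt x i - trdPt y i‖ := norm_sum_le _ _
      _ ≤ k * (2 * r + ‖empMean x - empMean y‖) :=
          sum_le_mul_of_dist_H_le hxy (by positivity) term_le (by simp +contextual)
  linarith

theorem mahalanobis_diagonal_sq (hσ : ∀ j, 0 < σ j) (v : EuclideanSpace ℝ (Fin d)) :
    mahalanobis (diagonal σ) v ^ 2 = ∑ j, v j ^ 2 / σ j := by
  have quad : v.ofLp ⬝ᵥ ((diagonal σ)⁻¹ *ᵥ v.ofLp) = ∑ j, v j ^ 2 / σ j := by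
    have : (diagonal σ)⁻¹ = diagonal fun j ↦ (σ j)⁻¹ :=
      inv_eq_right_inv (by simp [diagonal_mul_diagonal, (hσ _).ne'])
    rw [this, dotProduct]
    refine Finset.sum_congr rfl fun j _ ↦ ?_
    rw [mulVec_diagonal]
    ring
  rw [mahalanobis, Real.sq_sqrt, quad]
  rw [quad]
  exact Finset.sum_nonneg fun j _ ↦ div_nonneg (sq_nonneg _) (hσ j).le

theorem pos_of_empCov_eq_diagonal (hx : IsUnit (empCov x)) (hσ : empCov x = diagonal σ)
    (j : Fin d) : 0 < σ j :=
  posDef_diagonal_iff.1 (hσ ▸ posDef_empCov hx) j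

theorem sum_sq_div_le (hx : x ∈ Good n d lam) (hσ : empCov x = diagonal σ) (p : Fin (3 * n)) :
    ∑ j, (x p - empMean x) j ^ 2 / σ j ≤ lam := by
  rw [← mahalanobis_diagonal_sq (pos_of_empCov_eq_diagonal hx.1 hσ), ← hσ]
  exact hx.2 p

theorem sum_sq_fstPt_sub_sndPt_div_le (hx : x ∈ Good n d lam) (hσ : empCov x = diagonal σ)
    (i : Fin n) : ∑ j, (fstPt x i - sndPt x i) j ^ 2 / σ j ≤ 4 * lam := by
  have hpos := pos_of_empCov_eq_diagonal hx.1 hσ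
  have hfst : ∑ j, (fstPt x i - empMean x) j ^ 2 / σ j ≤ lam := sum_sq_div_le hx hσ _
  have hsnd : ∑ j, (sndPt x i - empMean x) j ^ 2 / σ j ≤ lam := sum_sq_div_le hx hσ _
  calc ∑ j, (fstPt x i - sndPt x i) j ^ 2 / σ j
      ≤ ∑ j, (2 * ((fstPt x i - empMean x) j ^ 2 / σ j) +
          2 * ((sndPt x i - empMean x) j ^ 2 / σ j)) := by
        refine Finset.sum_le_sum fun j _ ↦ ?_
        rw [← mul_div_assoc, ← mul_div_assoc, ← add_div]
        refine div_le_div_of_nonneg_right ?_ (hpos j).le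
        simp only [PiLp.sub_apply]
        nlinarith [sq_nonneg (fstPt x i j - empMean x j + (sndPt x i j - empMean x j))]
    _ ≤ 4 * lam := by
        rw [Finset.sum_add_distrib, ← Finset.mul_sum, ← Finset.mul_sum]
        linarith

theorem eq_sum_sq_of_empCov_eq_diagonal (hσ : empCov x = diagonal σ) (j : Fin d) :
    σ j = 1 / (2 * n) * ∑ i, (fstPt x i - sndPt x i) j ^ 2 := by
  rw [← diagonal_apply_eq σ j, ← hσ, empCov, Matrix.smul_apply, Matrix.sum_apply, smul_eq_mul]
  simp only [vecMulVec_apply, pow_two]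

/-- `trace (Σ⁻¹ Σ) = d`, while each of the `n` terms of `Σ` contributes at most `4 lam / (2 n)`. -/
theorem dimension_le (hn : 0 < n) (hx : x ∈ Good n d lam) (hσ : empCov x = diagonal σ) :
    (d : ℝ) ≤ 2 * lam := by
  have hpos := pos_of_empCov_eq_diagonal hx.1 hσ
  calc (d : ℝ) = ∑ j, σ j / σ j := by simp [(hpos _).ne']
    _ = 1 / (2 * n) * ∑ i, ∑ j, (fstPt x i - sndPt x i) j ^ 2 / σ j := by
        rw [Finset.sum_comm, Finset.mul_sum]
        refine Finset.sum_congr rfl fun j _ ↦ ?_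
        rw [← Finset.sum_div, ← mul_div_assoc, ← eq_sum_sq_of_empCov_eq_diagonal hσ]
    _ ≤ 1 / (2 * n) * ∑ i : Fin n, 4 * lam := by
        gcongr with i
        exact sum_sq_fstPt_sub_sndPt_div_le hx hσ i
    _ = 2 * lam := by
        rw [Finset.sum_const, Finset.card_univ, Fintype.card_fin, nsmul_eq_mul]
        field_simp
        norm_num

theorem sub_eq_sum_of_empCov_eq_diagonal {τ : Fin d → ℝ} (hσ : empCov x = diagonal σ)
    (hτ : empCov y = diagonal τ) (j : Fin d) : σ j - τ j = 1 / (2 * n) *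
      ∑ i, ((fstPt x i - sndPt x i) j ^ 2 - (fstPt y i - sndPt y i) j ^ 2) := by
  rw [eq_sum_sq_of_empCov_eq_diagonal hσ, eq_sum_sq_of_empCov_eq_diagonal hτ, ← mul_sub,
    Finset.sum_sub_distrib]

theorem variance_ratio_le (hn : 0 < n) (hlam : 0 ≤ lam) {τ : Fin d → ℝ} (hx : x ∈ Good n d lam)
    (hσ : empCov x = diagonal σ) (hτ : empCov y = diagonal τ) (hxy : (dist_H x y : ℝ) ≤ k)
    (j : Fin d) : (1 - 2 * k * lam / n) * σ j ≤ τ j := by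
  have hpos := pos_of_empCov_eq_diagonal hx.1 hσ
  have term_le (i : Fin n) : (fstPt x i - sndPt x i) j ^ 2 - (fstPt y i - sndPt y i) j ^ 2 ≤
      4 * lam * σ j := by
    have single_le : (fstPt x i - sndPt x i) j ^ 2 / σ j ≤ 4 * lam :=
      (Finset.single_le_sum (f := fun j ↦ (fstPt x i - sndPt x i) j ^ 2 / σ j)
        (fun j _ ↦ div_nonneg (sq_nonneg _) (hpos j).le) (Finset.mem_univ j)).trans
        (sum_sq_fstPt_sub_sndPt_div_le hx hσ i)
    linarith [(div_le_iff₀ (hpos j)).1 single_le, sq_nonneg ((fstPt y i - sndPt y i) j)]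
  have diff_le : σ j - τ j ≤ 1 / (2 * n) * (k * (4 * lam * σ j)) := by
    rw [sub_eq_sum_of_empCov_eq_diagonal hσ hτ]
    gcongr
    exact sum_le_mul_of_dist_H_le hxy (mul_nonneg (by positivity) (hpos j).le) term_le
      (by simp +contextual)
  have : 1 / (2 * n) * (k * (4 * lam * σ j)) = 2 * k * lam / n * σ j := by
    field_simp
    ring
  linarith

theorem sum_sq_le_div {v : Fin d → ℝ} {c q : ℝ} (hq : 0 < q) (hσ : ∀ j, 0 < σ j)
    (hqσ : ∀ j, q * σ j ≤ 1) (hv : ∑ j, v j ^ 2 / σ j ≤ c) : ∑ j, v j ^ 2 ≤ c / q := by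
  rw [le_div_iff₀ hq, Finset.sum_mul]
  refine (Finset.sum_le_sum fun j _ ↦ ?_).trans hv
  rw [le_div_iff₀ (hσ j), mul_assoc]
  exact mul_le_of_le_one_right (sq_nonneg _) (hqσ j)

theorem sum_abs_sub_variance_le {τ : Fin d → ℝ} {a b : ℝ} (hab : 0 ≤ a + b)
    (hσ : empCov x = diagonal σ) (hτ : empCov y = diagonal τ) (hxy : (dist_H x y : ℝ) ≤ k)
    (hx : ∀ i, ∑ j, (fstPt x i - sndPt x i) j ^ 2 ≤ a)
    (hy : ∀ i, ∑ j, (fstPt y i - sndPt y i) j ^ 2 ≤ b) :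
    ∑ j, |σ j - τ j| ≤ 1 / (2 * n) * (k * (a + b)) := by
  have term_le (i : Fin n) :
      ∑ j, |(fstPt x i - sndPt x i) j ^ 2 - (fstPt y i - sndPt y i) j ^ 2| ≤ a + b := by
    refine (Finset.sum_le_sum fun j _ ↦ abs_sub _ _).trans ?_
    simp only [abs_pow, sq_abs, Finset.sum_add_distrib]
    exact add_le_add (hx i) (hy i)
  calc ∑ j, |σ j - τ j|
      ≤ ∑ j, 1 / (2 * n) *
          ∑ i, |(fstPt x i - sndPt x i) j ^ 2 - (fstPt y i - sndPt y i) j ^ 2| := by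
        refine Finset.sum_le_sum fun j _ ↦ ?_
        rw [sub_eq_sum_of_empCov_eq_diagonal hσ hτ, abs_mul, abs_of_nonneg (by positivity)]
        gcongr
        exact Finset.abs_sum_le_sum_abs _ _
    _ = 1 / (2 * n) *
        ∑ i, ∑ j, |(fstPt x i - sndPt x i) j ^ 2 - (fstPt y i - sndPt y i) j ^ 2| := by
        rw [Finset.sum_comm, Finset.mul_sum]
    _ ≤ 1 / (2 * n) * (k * (a + b)) := by
        gcongr
        exact sum_le_mul_of_dist_H_le hxy hab term_le (by simp +contextual)

/-- The bound `τ` on `∑ⱼ |1 - σⱼ|`, where the `σⱼ` are the eigenvalues of `Σ_y⁻¹ Σ_x` for good data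
sets `x`, `y` at Hamming distance at most `k`. -/
noncomputable def covRadius (n : ℕ) (lam k : ℝ) : ℝ :=
  2 * k * lam * (1 / (n - 2 * k * lam) + 1 / n)

theorem sum_abs_one_sub_variance_le (hn : 0 < n) (hlam : 0 ≤ lam) (hk : 2 * k * lam < n)
    (hx : x ∈ Good n d lam) (hy : y ∈ Good n d lam) (hσ : empCov x = diagonal σ)
    (hy1 : empCov y = 1) (hxy : (dist_H x y : ℝ) ≤ k) :
    ∑ j, |1 - σ j| ≤ covRadius n lam k := by
  have hn' : (0 : ℝ) < n := Nat.cast_pos.2 hn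
  have hτ : empCov y = diagonal fun _ ↦ 1 := hy1.trans diagonal_one.symm
  set q := 1 - 2 * k * lam / n with hq
  have hq0 : 0 < q := sub_pos.2 ((div_lt_one hn').2 hk)
  have hΔx (i : Fin n) : ∑ j, (fstPt x i - sndPt x i) j ^ 2 ≤ 4 * lam / q :=
    sum_sq_le_div hq0 (pos_of_empCov_eq_diagonal hx.1 hσ) (variance_ratio_le hn hlam hx hσ hτ hxy)
      (sum_sq_fstPt_sub_sndPt_div_le hx hσ i)
  have hΔy (i : Fin n) : ∑ j, (fstPt y i - sndPt y i) j ^ 2 ≤ 4 * lam := by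
    simpa using sum_sq_fstPt_sub_sndPt_div_le hy hτ i
  simp_rw [abs_sub_comm (1 : ℝ)]
  calc ∑ j, |σ j - 1| ≤ 1 / (2 * n) * (k * (4 * lam / q + 4 * lam)) :=
        sum_abs_sub_variance_le (by positivity) hσ hτ hxy hΔx hΔy
    _ = covRadius n lam k := by
        rw [covRadius, hq, one_sub_div hn'.ne']
        have := (sub_pos.2 hk).ne'
        field_simp
        ring

theorem norm_sub_empMean_le (hn : 0 < n) (hlam : 0 ≤ lam) (hk : 2 * k * lam < n)
    (hx : x ∈ Good n d lam) (hσ : empCov x = diagonal σ) (hy1 : empCov y = 1)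
    (hxy : (dist_H x y : ℝ) ≤ k) (p : Fin (3 * n)) :
    ‖x p - empMean x‖ ≤ √(lam / (1 - 2 * k * lam / n)) := by
  refine Real.le_sqrt_of_sq_le ?_
  rw [EuclideanSpace.real_norm_sq_eq]
  exact sum_sq_le_div (sub_pos.2 ((div_lt_one (Nat.cast_pos.2 hn)).2 hk))
    (pos_of_empCov_eq_diagonal hx.1 hσ)
    (variance_ratio_le hn hlam hx hσ (hy1.trans diagonal_one.symm) hxy) (sum_sq_div_le hx hσ p)

/-- The constant `8` rests on `k ≤ n / 10`, a consequence of `lam ≥ 1 / 2` when `d ≠ 0`. -/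
theorem norm_empMean_sub_sq_le (hn : 0 < n) (hlam : 0 ≤ lam) (hk : 20 * k * lam ≤ n)
    (hx : x ∈ Good n d lam) (hy : y ∈ Good n d lam) (hσ : empCov x = diagonal σ)
    (hy1 : empCov y = 1) (hxy : (dist_H x y : ℝ) ≤ k) :
    ‖empMean x - empMean y‖ ^ 2 ≤ 8 * k ^ 2 / n ^ 2 * (lam / (1 - 2 * k * lam / n)) := by
  have hn' : (0 : ℝ) < n := Nat.cast_pos.2 hn
  have hk0 : 0 ≤ k := (Nat.cast_nonneg _).trans hxy
  have : 0 ≤ k * lam := mul_nonneg hk0 hlam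
  have hq : 0 < 1 - 2 * k * lam / n := sub_pos.2 ((div_lt_one hn').2 (by linarith))
  set r := √(lam / (1 - 2 * k * lam / n))
  have hr_sq : r ^ 2 = lam / (1 - 2 * k * lam / n) := Real.sq_sqrt (by positivity)
  have radius_x (p) : ‖x p - empMean x‖ ≤ r :=
    norm_sub_empMean_le hn hlam (by linarith) hx hσ hy1 hxy p
  have radius_y (p) : ‖y p - empMean y‖ ≤ r := by
    refine (Real.le_sqrt_of_sq_le (?_ : _ ≤ lam)).trans (Real.sqrt_le_sqrt ?_)
    · rw [EuclideanSpace.real_norm_sq_eq]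
      simpa using sum_sq_div_le hy (hy1.trans diagonal_one.symm) p
    · exact le_div_self hlam hq (sub_le_self _ (by positivity))
  rcases Nat.eq_zero_or_pos d with rfl | hd
  · rw [Subsingleton.elim (empMean x - empMean y) 0, norm_zero, zero_pow two_ne_zero]
    positivity
  have hk10 : 10 * k ≤ n := by
    have : (1 : ℝ) ≤ d := Nat.one_le_cast.2 hd
    nlinarith [dimension_le hn hx hσ]
  have norm_le : ‖empMean x - empMean y‖ ≤ 20 / 9 * (k * r / n) := by
    rw [← mul_div_assoc, le_div_iff₀ hn']
    nlinarith [norm_empMean_sub_le hn (Real.sqrt_nonneg _) hxy radius_x radius_y,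
      norm_nonneg (empMean x - empMean y)]
  calc ‖empMean x - empMean y‖ ^ 2 ≤ (20 / 9 * (k * r / n)) ^ 2 := by gcongr
    _ = 400 / 81 * (k ^ 2 / n ^ 2 * r ^ 2) := by ring
    _ ≤ 8 * (k ^ 2 / n ^ 2 * r ^ 2) := by gcongr; norm_num
    _ = 8 * k ^ 2 / n ^ 2 * (lam / (1 - 2 * k * lam / n)) := by rw [hr_sq]; ring

end Perturbation

section Indistinguishability

variable {n d : ℕ} {x y : DataSet n d} {σ : Fin d → ℝ} {ε δ lam k : ℝ}

theorem covRadius_pos (hn : 0 < n) (hk : 0 < k) (hlam : 0 < lam) (hnk : 2 * k * lam < n) :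
    0 < covRadius n lam k := by
  have : (0 : ℝ) < n := Nat.cast_pos.2 hn
  have := sub_pos.2 hnk
  unfold covRadius
  positivity

theorem mul_le_of_covRadius_le (hn : 0 < n) (hk : 0 ≤ k) (hlam : 0 ≤ lam) (hnk : 2 * k * lam < n)
    (h : covRadius n lam k ≤ 1 / 5) : 20 * k * lam ≤ n := by
  have hn' : (0 : ℝ) < n := Nat.cast_pos.2 hn
  have : 4 * k * lam / n ≤ 1 / 5 :=
    calc 4 * k * lam / n = 2 * k * lam * (1 / n + 1 / n) := by ring
      _ ≤ covRadius n lam k := by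
          unfold covRadius
          gcongr
          exact sub_le_self _ (by positivity)
      _ ≤ 1 / 5 := h
  rw [div_le_iff₀ hn'] at this
  linarith

theorem neg_log_le_log_div {c : ℝ} (hc : 1 ≤ c) (hδ : 0 < δ) : -Real.log δ ≤ Real.log (c / δ) := by
  rw [Real.log_div (by positivity) hδ.ne']
  linarith [Real.log_nonneg hc]

theorem covRadius_le_of_lt_neg_log (hε : 0 < ε) (hδ : 0 < δ) (hεδ : ε < -Real.log δ)
    (hεk : 5 * covRadius n lam k * Real.log (2 / δ) ≤ ε) : covRadius n lam k ≤ 1 / 5 := by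
  have hlog : ε < Real.log (2 / δ) := hεδ.trans_le (neg_log_le_log_div (by norm_num) hδ)
  have : 5 * covRadius n lam k < 1 :=
    lt_of_mul_lt_mul_right (by linarith) (hε.trans hlog).le
  linarith

/-- The squared noise scale `C ^ 2`. -/
noncomputable def noiseVariance (n : ℕ) (ε δ lam k : ℝ) : ℝ :=
  32 * k ^ 2 / (ε ^ 2 * n ^ 2) * (lam / (1 - 2 * k * lam / n)) * Real.log (1.25 / δ)

theorem noiseVariance_pos (hn : 0 < n) (hε : 0 < ε) (hk : 0 < k) (hlam : 0 < lam)
    (hnk : 2 * k * lam < n) (hδ : 0 < Real.log (1.25 / δ)) : 0 < noiseVariance n ε δ lam k := by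
  have hn' : (0 : ℝ) < n := Nat.cast_pos.2 hn
  have := sub_pos.2 ((div_lt_one hn').2 hnk)
  unfold noiseVariance
  positivity

theorem approxLE_of_empCov_eq_diagonal (hn : 0 < n) (hε : 0 < ε) (hδ : 0 < δ) (hlam : 0 < lam)
    (hk : 0 < k) (hnk : 2 * k * lam < n) (hεk : 5 * covRadius n lam k * Real.log (2 / δ) ≤ ε)
    (hεδ : ε < -Real.log δ) (hx : x ∈ Good n d lam) (hy : y ∈ Good n d lam)
    (hxy : (dist_H x y : ℝ) ≤ k) (hσ : empCov x = diagonal σ) (hy1 : empCov y = 1) :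
    ApproxLE (ε + ε) (δ + Real.exp ε * δ)
      (multivariateGaussian (empMean x) (noiseVariance n ε δ lam k • empCov x))
      (multivariateGaussian (empMean y) (noiseVariance n ε δ lam k • empCov y)) := by
  have hδL : -Real.log δ ≤ Real.log (1.25 / δ) := neg_log_le_log_div (by norm_num) hδ
  have hL : 0 < Real.log (1.25 / δ) := by linarith
  have hδ1 : δ ≤ 1 := ((Real.log_neg_iff hδ).1 (by linarith)).le
  have hτ5 := covRadius_le_of_lt_neg_log hε hδ hεδ hεk
  have hv := noiseVariance_pos hn hε hk hlam hnk hL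
  have mean_close : ‖empMean x - empMean y‖ ^ 2 ≤
      noiseVariance n ε δ lam k * ε ^ 2 / (4 * Real.log (1.25 / δ)) := by
    convert norm_empMean_sub_sq_le hn hlam.le (mul_le_of_covRadius_le hn hk.le hlam.le hnk hτ5)
      hx hy hσ hy1 hxy using 1
    rw [noiseVariance]
    field_simp
    ring
  rw [hσ, hy1]
  exact (approxLE_multivariateGaussian_of_cov _ hv hδ hδ1 (covRadius_pos hn hk hlam hnk) hτ5
    (sum_abs_one_sub_variance_le hn hlam.le hnk hx hy hσ hy1 hxy) hεk).trans
    (approxLE_multivariateGaussian_of_mean hv hδ hε (hεδ.le.trans hδL) hδL mean_close)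

theorem ApproxLE.of_mem_good (hn : 0 < n) (hε : 0 < ε) (hδ : 0 < δ) (hlam : 0 < lam)
    (hk : 0 < k) (hnk : 2 * k * lam < n) (hεk : 5 * covRadius n lam k * Real.log (2 / δ) ≤ ε)
    (hx : x ∈ Good n d lam) (hy : y ∈ Good n d lam) (hxy : (dist_H x y : ℝ) ≤ k) :
    ApproxLE (2 * ε) ((1 + Real.exp ε) * δ)
      (multivariateGaussian (empMean x) (noiseVariance n ε δ lam k • empCov x))
      (multivariateGaussian (empMean y) (noiseVariance n ε δ lam k • empCov y)) := by
  rcases le_or_gt 1 ((1 + Real.exp ε) * δ) with hδ1 | hδ1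
  · exact .of_one_le hδ1
  have hεδ : ε < -Real.log δ := by
    rw [← Real.log_inv, Real.lt_log_iff_exp_lt (by positivity), lt_inv_comm₀ (by positivity) hδ,
      ← one_div, lt_div_iff₀ (by positivity)]
    linarith
  obtain ⟨M, σ, hM, hMx, hMy⟩ := exists_whitening (posSemidef_empCov x).isHermitian
    (posDef_empCov hy.1)
  rw [conjTranspose_eq_transpose_of_trivial, ← empCov_linearImage] at hMx hMy
  have hv : 0 ≤ noiseVariance n ε δ lam k := (noiseVariance_pos hn hε hk hlam hnk
    (by linarith [neg_log_le_log_div (c := 1.25) (by norm_num) hδ])).le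
  refine .of_conjugate hM ((posSemidef_empCov x).smul hv) ((posSemidef_empCov y).smul hv) ?_
  simp only [Matrix.mul_smul, Matrix.smul_mul, ← empMean_linearImage, ← empCov_linearImage]
  rw [two_mul, one_add_mul]
  exact approxLE_of_empCov_eq_diagonal hn hε hδ hlam hk hnk hεk hεδ (linearImage_mem_good hM hx)
    (linearImage_mem_good hM hy) ((Nat.cast_le.2 (dist_H_linearImage_le M x y)).trans hxy) hMx hMy

end Indistinguishability

end RescaledGaussian

theorem theorem4p11 (n d : ℕ) (ε δ lam k : ℝ)
    (hn : 0 < n) (hε : 0 < ε) (hδ : 0 < δ) (hlam : 0 < lam) (hk : 0 < k)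
    (hnk : 2 * k * lam < (n : ℝ))
    (hεk : 10 * k * lam * (1 / ((n : ℝ) - 2 * k * lam) + 1 / (n : ℝ)) * Real.log (2 / δ) ≤ ε)
    (C : ℝ)
    (hC : C ^ 2 = 32 * k ^ 2 / (ε ^ 2 * (n : ℝ) ^ 2) * (lam / (1 - 2 * k * lam / (n : ℝ)))
      * Real.log (1.25 / δ))
    (x y : RescaledGaussian.DataSet n d)
    (hx : x ∈ RescaledGaussian.Good n d lam) (hy : y ∈ RescaledGaussian.Good n d lam)
    (hxy : (RescaledGaussian.dist_H x y : ℝ) ≤ k) :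
    RescaledGaussian.Indistinguishable (2 * ε) ((1 + Real.exp ε) * δ)
      (ProbabilityTheory.multivariateGaussian (RescaledGaussian.empMean x)
        (C ^ 2 • RescaledGaussian.empCov x))
      (ProbabilityTheory.multivariateGaussian (RescaledGaussian.empMean y)
        (C ^ 2 • RescaledGaussian.empCov y)) := by
  have hεk' : 5 * RescaledGaussian.covRadius n lam k * Real.log (2 / δ) ≤ ε := by
    rw [RescaledGaussian.covRadius]
    linarith
  have hyx : (RescaledGaussian.dist_H y x : ℝ) ≤ k := by
    rwa [RescaledGaussian.dist_H, hammingDist_comm]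
  rw [hC, RescaledGaussian.indistinguishable_iff_approxLE]
  exact ⟨.of_mem_good hn hε hδ hlam hk hnk hεk' hx hy hxy,
    .of_mem_good hn hε hδ hlam hk hnk hεk' hy hx hyx⟩
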